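/- **Definitions.** All graphs are simple and undirected; $N_X(u)$ is the set of neighbours of a vertex $u$ of $X$, and a graph is $k$-regular if each vertex has exactly $k$ neighbours ($k$ a nonnegative integer). A (discrete) group $\Gamma$ has *property (T)* if there are a finite subset $Q\subset\Gamma$ and $\varepsilon>0$ such that every unitary representation $\pi$ of $\Gamma$ on a complex Hilbert space $\mathcal H$ for which some $\xi\in\mathcal H$ satisfies $\sup_{x\in Q}\|\pi(x)\xi-\xi\|<\varepsilon\|\xi\|$ has a non-zero invariant vector. A *Kazhdan graph structure* is a pair $(X,\Gamma)$ with $X$ a regular graph and $\Gamma\le\mathrm{Aut}(X)$ a group of automorphisms such that $V(X)/\Gamma$ is finite, all vertex stabilizers $\Gamma_x$ are finite, and $\Gamma$ has property (T). For connected graphs $X,Y$, a *covering map* $p:X\to Y$ is a map $V(X)\to V(Y)$ which sends adjacent vertices to adjacent vertices and which, for every $u\in V(X)$, maps $N_X(u)$ bijectively onto $N_Y(p(u))$; then $X$ *covers* $Y$, and $\mathrm{Cov}(p)=\{\alpha\in\mathrm{Aut}(X): p\circ\alpha=p\}$. A finite $d$-regular graph with vertex set $V$, $|V|=n$, is an *$(n,d,c)$-expander*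 if $|\partial A|\ge c\left(1-\frac{|A|}{n}\right)|A|$ for all $A\subseteq V$, where $\partial A=\{y\in V: d(y,A)=1\}$, the distance being the graph distance. A family of finite graphs $(X_i)_{i\in I}$ is a *family of expanders* if there are $d$ and a single $c>0$ such that each $X_i$ is a $(|V(X_i)|,d,c)$-expander. A graph $X$ has *property $(\tau)$ with respect to* $(X_i)_{i\in I}$ if for each $i\in I$ there is a covering map $X\to X_i$, and $(X_i)_{i\in I}$ is a family of expanders. **Proposition 6.1.** Let $(X,\Gamma)$ be a Kazhdan graph structure, $k$ a nonnegative integer, and $(X_i)_{i\in I}$ a family of finite $k$-regular graphs such that for each $i\in I$ there is a covering map $p_i:X\to X_i$ for which $\mathrm{Cov}(p_i)$ is a subgroup of finite index in $\Gamma$. Then $X$ has property $(\tau)$ with respect to $(X_i)_{i\in I}$. -/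

import Mathlib

universe u v w

/-! ### Kazhdan's property (T) for discrete groups -/

section PropertyT

variable {G : Type u} [Group G] {H : Type v} [NormedAddCommGroup H] [InnerProductSpace ℂ H]

/-- For a unitary representation `π` of `G` on `H`, a vector `ξ` is `(Q, ε)`-invariant if
`sup_{x ∈ Q} ‖π(x) ξ - ξ‖ < ε ‖ξ‖`. The supremum is one of nonnegative reals bounded by `2 ‖ξ‖`;
for empty `Q` it is `0`. In particular such a `ξ` is nonzero. -/
def IsAlmostInvariantVector (π : G →* (H ≃ₗᵢ[ℂ] H)) (Q : Set G) (ε : ℝ) (ξ : H) : Prop :=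
  (⨆ x : Q, ‖π x ξ - ξ‖) < ε * ‖ξ‖

/-- The representation `π` has a nonzero invariant vector. -/
def HasNonzeroInvariantVector (π : G →* (H ≃ₗᵢ[ℂ] H)) : Prop :=
  ∃ ξ : H, ξ ≠ 0 ∧ ∀ g : G, π g ξ = ξ

theorem isAlmostInvariantVector_iff (π : G →* (H ≃ₗᵢ[ℂ] H)) {Q : Set G} (hQ : Q.Finite) {ε : ℝ}
    (hε : 0 < ε) (ξ : H) :
    IsAlmostInvariantVector π Q ε ξ ↔ ξ ≠ 0 ∧ ∀ x ∈ Q, ‖π x ξ - ξ‖ < ε * ‖ξ‖ := by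
  have : Finite Q := hQ
  unfold IsAlmostInvariantVector
  constructor
  · intro h
    refine ⟨?_, fun x hx => ?_⟩
    · rintro rfl
      simp at h
    · exact (le_ciSup (f := fun x : Q => ‖π x ξ - ξ‖) (Set.finite_range _).bddAbove
        ⟨x, hx⟩).trans_lt h
  · rintro ⟨h0, h⟩
    cases isEmpty_or_nonempty Q with
    | inl hE =>
      rw [Real.iSup_of_isEmpty]
      exact mul_pos hε (norm_pos_iff.mpr h0)
    | inr hN =>
      obtain ⟨x, hx⟩ := exists_eq_ciSup_of_finite (f := fun x : Q => ‖π x ξ - ξ‖)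
      rw [← hx]
      exact h x x.2

end PropertyT

/-- Kazhdan's property (T) of a discrete group `G`: there are a finite `Q ⊆ G` and `ε > 0` such
that every unitary representation of `G` on a Hilbert space with a `(Q, ε)`-invariant vector has a
nonzero invariant vector. (The Hilbert spaces range over the universe of `G`; since the closed
invariant subspace generated by one vector is the closed span of an orbit of `G`, this is no
restriction.) -/
def HasPropertyT (G : Type u) [Group G] : Prop :=
  ∃ (Q : Finset G) (ε : ℝ), 0 < ε ∧
    ∀ (H : Type u) [NormedAddCommGroup H] [InnerProductSpace ℂ H] [CompleteSpace H]
      (π : G →* (H ≃ₗᵢ[ℂ] H)),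
      (∃ ξ : H, IsAlmostInvariantVector π (Q : Set G) ε ξ) → HasNonzeroInvariantVector π

/-! ### Graphs, coverings, Kazhdan graph structures -/

namespace SimpleGraph

variable {V : Type u} {W : Type v}

/-- `X` is `k`-regular: each vertex has exactly `k` neighbours (`k` finite). -/
def IsKRegular (X : SimpleGraph V) (k : ℕ) : Prop :=
  ∀ x : V, (X.neighborSet x).encard = k

/-- `p` is a covering map of the connected graph `X` onto the connected graph `Y`. -/
structure IsCoveringMap (X : SimpleGraph V) (Y : SimpleGraph W) (p : V → W) : Prop where
  connected_source : X.Connected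
  connected_target : Y.Connected
  map_adj : ∀ ⦃a b : V⦄, X.Adj a b → Y.Adj (p a) (p b)
  bijOn_neighborSet : ∀ a : V, Set.BijOn p (X.neighborSet a) (Y.neighborSet (p a))

/-- The group `Cov(p)` of covering transformations: automorphisms `α` of `X` with `p ∘ α = p`. -/
def Cov (X : SimpleGraph V) (p : V → W) : Subgroup (X ≃g X) where
  carrier := {α | p ∘ α = p}
  one_mem' := rfl
  mul_mem' := by
    intro α β hα hβ
    funext x
    exact (congrFun hα (β x)).trans (congrFun hβ x)
  inv_mem' := by
    intro α hα
    funext x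
    have h := congrFun hα (α⁻¹ x)
    simp only [Function.comp_apply, RelIso.apply_inv_self] at h
    exact h.symm

/-- `(X, Γ)` is a Kazhdan graph structure: `X` is a regular graph and `Γ` is a group of
automorphisms of `X` with finitely many vertex orbits, finite vertex stabilizers and
property (T). -/
structure IsKazhdanGraphStructure (X : SimpleGraph V) (Γ : Subgroup (X ≃g X)) : Prop where
  regular : ∃ d : ℕ, X.IsKRegular d
  finite_orbits : Finite (MulAction.orbitRel.Quotient Γ V)
  finite_stabilizer : ∀ x : V, Finite (MulAction.stabilizer Γ x)
  propertyT : HasPropertyT Γ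

/-! ### Expanders and property (τ) -/

/-- The boundary `∂A = {y | d(y, A) = 1}` of a set of vertices, where `d(y, A)` is the infimum in
`ℕ∞` of the graph distances from `y` to the points of `A`. -/
def vertexBoundary (Y : SimpleGraph W) (A : Set W) : Set W :=
  {y | ⨅ a ∈ A, Y.edist y a = 1}

theorem mem_vertexBoundary (Y : SimpleGraph W) (A : Set W) (y : W) :
    y ∈ Y.vertexBoundary A ↔ y ∉ A ∧ ∃ a ∈ A, Y.Adj y a := by
  simp only [vertexBoundary, Set.mem_ofPred_eq]
  constructor
  · intro h
    refine ⟨fun hy => ?_, ?_⟩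
    · have h1 : (⨅ a ∈ A, Y.edist y a) ≤ Y.edist y y := iInf₂_le y hy
      rw [h, edist_self] at h1
      simp at h1
    · by_contra! hc
      have h2 : (2 : ℕ∞) ≤ ⨅ a ∈ A, Y.edist y a := by
        refine le_iInf₂ fun a ha => ?_
        by_contra! hlt
        have hle : Y.edist y a ≤ 1 := by
          have : Y.edist y a < 1 + 1 := by rwa [one_add_one_eq_two]
          exact Order.le_of_lt_add_one this
        rcases edist_le_one_iff_adj_or_eq.mp hle with hadj | rfl
        · exact hc a ha hadj
        · have h3 : (⨅ b ∈ A, Y.edist y b) ≤ Y.edist y y := iInf₂_le y ha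
          rw [h, edist_self] at h3
          simp at h3
      rw [h] at h2
      exact absurd h2 (by decide)
  · rintro ⟨hy, a, ha, hadj⟩
    refine le_antisymm ((iInf₂_le a ha).trans (edist_eq_one_iff_adj.mpr hadj).le) ?_
    refine le_iInf₂ fun b hb => ?_
    rw [Order.one_le_iff_ne_zero]
    intro h0
    rw [edist_eq_zero_iff] at h0
    exact hy (h0 ▸ hb)

/-- A finite `d`-regular graph `Y` with `n` vertices is an `(n, d, c)`-expander if
`|∂A| ≥ c (1 - |A| / n) |A|` for every set `A` of vertices. -/
structure IsExpander (Y : SimpleGraph W) (n d : ℕ) (c : ℝ) : Prop where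
  finite : Finite W
  card_eq : Nat.card W = n
  regular : Y.IsKRegular d
  boundary_ge : ∀ A : Set W,
    c * (1 - (A.ncard : ℝ) / (n : ℝ)) * (A.ncard : ℝ) ≤ ((Y.vertexBoundary A).ncard : ℝ)

/-- A family of expanders: all members are `(|V(Y i)|, d, c)`-expanders for one degree `d` and one
constant `c > 0`. -/
def IsExpanderFamily {I : Type w} {W : I → Type v} (Y : ∀ i, SimpleGraph (W i)) : Prop :=
  ∃ (d : ℕ) (c : ℝ), 0 < c ∧ ∀ i, (Y i).IsExpander (Nat.card (W i)) d c

/-- The graph `X` has property (τ) with respect to the family `Y` of graphs. -/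
structure HasPropertyTau (X : SimpleGraph V) {I : Type w} {W : I → Type v}
    (Y : ∀ i, SimpleGraph (W i)) : Prop where
  covered : ∀ i, ∃ p : V → W i, X.IsCoveringMap (Y i) p
  expanders : IsExpanderFamily Y

end SimpleGraph

/-! Put `L = Cov(p)`, a finite-index subgroup of `Γ`, and `N = |Γ ⧸ L|`. Since `Γ` is transitive on
`Γ ⧸ L`, the zero-sum functions there contain no nonzero invariant vector. Property (T) therefore
makes some `g ∈ Q` move the centred indicator of any `B ⊆ Γ ⧸ L`, so `|B| (N - |B|) ≤ C N ∑ |gB ∆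
B|` with `C` independent of `L` (`HasPropertyT.exists_isoperimetric`).

For a set `A` of vertices of the base, let `B_x` be the set of cosets `gL` with `p(g⁻¹x) ∈ A`
(`visitSet`). Then `hB_x = B_{hx}`, and for adjacent `x`, `y` a coset in `B_x ∆ B_y` sends `x` or
`y` over `∂A`. Following fixed walks in `X` gives `|B_x ∆ B_y| ≤ K(x, y) m |∂A|`, where `m` is the
common fibre size of `L \ V → W`; the covering need not be regular, so `m` may exceed `1`. Summing
over the finitely many `Γ`-orbit representatives turns the inequality for the sets `B_x` into one
for `A`. The powers of `m` cancel, and what remains depends only on `(X, Γ)`. -/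

/-! ### Property (T) and finite transitive actions -/

section TransitiveAction

open scoped symmDiff

variable {G : Type u} [Group G] {S : Type v} [Fintype S] [MulAction G S]

/-- The functions with vanishing sum in `ℓ²(S)`. -/
def zeroSum (S : Type v) [Fintype S] : Submodule ℂ (EuclideanSpace ℂ S) where
  carrier := {F | ∑ s, F s = 0}
  zero_mem' := by simp
  add_mem' := by
    intro a b ha hb
    simp only [Set.mem_ofPred_eq] at *
    simp [Finset.sum_add_distrib, ha, hb]
  smul_mem' := by
    intro c a ha
    simp only [Set.mem_ofPred_eq] at *
    simp [← Finset.mul_sum, ha]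

theorem mem_zeroSum {F : EuclideanSpace ℂ S} : F ∈ zeroSum S ↔ ∑ s, F s = 0 := Iff.rfl

/-- Translation by `g` on the functions with vanishing sum. -/
def zeroSumTranslate (g : G) (F : zeroSum S) : zeroSum S :=
  ⟨WithLp.toLp 2 fun s => F.1 (g⁻¹ • s), by
    rw [mem_zeroSum, ← mem_zeroSum.mp F.2]
    exact Equiv.sum_comp (MulAction.toPerm g⁻¹) (fun s => F.1 s)⟩

@[simp]
theorem zeroSumTranslate_apply (g : G) (F : zeroSum S) (s : S) :
    (zeroSumTranslate g F).1 s = F.1 (g⁻¹ • s) := rfl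

theorem zeroSum_ext {F F' : zeroSum S} (h : ∀ s, F.1 s = F'.1 s) : F = F' := by
  ext s
  exact h s

/-- The quasi-regular representation on the functions with vanishing sum. -/
def zeroSumRep (G : Type u) [Group G] (S : Type v) [Fintype S] [MulAction G S] :
    G →* (zeroSum S ≃ₗᵢ[ℂ] zeroSum S) where
  toFun g :=
    { toFun := zeroSumTranslate g
      invFun := zeroSumTranslate g⁻¹
      left_inv := fun F => zeroSum_ext fun s => by simp
      right_inv := fun F => zeroSum_ext fun s => by simp
      map_add' := fun F F' => zeroSum_ext fun s => rfl
      map_smul' := fun c F => zeroSum_ext fun s => rfl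
      norm_map' := fun F => by
        change ‖(zeroSumTranslate g F).1‖ = ‖F.1‖
        rw [EuclideanSpace.norm_eq, EuclideanSpace.norm_eq]
        congr 1
        exact Equiv.sum_comp (MulAction.toPerm g⁻¹) (fun s => ‖F.1 s‖ ^ 2) }
  map_one' := by
    ext F s
    change F.1 ((1 : G)⁻¹ • s) = F.1 s
    simp
  map_mul' g h := by
    ext F s
    change F.1 ((g * h)⁻¹ • s) = F.1 (h⁻¹ • g⁻¹ • s)
    rw [mul_inv_rev, mul_smul]

theorem zeroSumRep_apply (g : G) (F : zeroSum S) (s : S) :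
    (zeroSumRep G S g F).1 s = F.1 (g⁻¹ • s) := rfl

theorem not_hasNonzeroInvariantVector_zeroSumRep [MulAction.IsPretransitive G S] :
    ¬ HasNonzeroInvariantVector (H := zeroSum S) (zeroSumRep G S) := by
  rintro ⟨F, hF, hinv⟩
  refine hF (zeroSum_ext fun s => ?_)
  have hconst : ∀ t, F.1 t = F.1 s := fun t => by
    obtain ⟨g, rfl⟩ := MulAction.exists_smul_eq G t s
    have h := zeroSumRep_apply g F (g • t)
    rw [hinv g] at h
    rw [h, inv_smul_smul]
  have h0 := mem_zeroSum.mp F.2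
  simp only [hconst, Finset.sum_const, Finset.card_univ, nsmul_eq_mul] at h0
  have : Nonempty S := ⟨s⟩
  exact (mul_eq_zero.mp h0).resolve_left (Nat.cast_ne_zero.mpr Fintype.card_ne_zero)

theorem sum_ite_mem_card {R : Type*} [Semiring R] (B : Set S) [DecidablePred (· ∈ B)] :
    ∑ s, (if s ∈ B then (1 : R) else 0) = B.ncard := by
  rw [Finset.sum_boole, Set.ncard_eq_toFinset_card', ← Set.filter_mem_univ_eq_toFinset]

open Classical in
/-- The multiple by `|S|` of the projection of the indicator function of `B` to the functions with
vanishing sum. -/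
noncomputable def centeredIndicator (B : Set S) : zeroSum S :=
  ⟨WithLp.toLp 2 fun s => (Fintype.card S : ℂ) * (if s ∈ B then 1 else 0) - B.ncard, by
    simp only [mem_zeroSum, Finset.sum_sub_distrib, ← Finset.mul_sum, sum_ite_mem_card]
    simp⟩

open Classical in
theorem centeredIndicator_apply (B : Set S) (s : S) :
    (centeredIndicator B).1 s = (Fintype.card S : ℂ) * (if s ∈ B then 1 else 0) - B.ncard := rfl

theorem norm_sq_centeredIndicator (B : Set S) :
    ‖centeredIndicator B‖ ^ 2 =
      (Fintype.card S : ℝ) * (B.ncard * ((Fintype.card S : ℝ) - B.ncard)) := by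
  classical
  have h : ∀ s, ‖(centeredIndicator B).1 s‖ ^ 2 =
      (Fintype.card S : ℝ) * ((Fintype.card S : ℝ) - 2 * B.ncard) * (if s ∈ B then 1 else 0)
        + (B.ncard : ℝ) ^ 2 := fun s => by
    rw [centeredIndicator_apply]
    split_ifs
    · rw [mul_one, ← Complex.ofReal_natCast, ← Complex.ofReal_natCast, ← Complex.ofReal_sub,
        Complex.norm_real, Real.norm_eq_abs, sq_abs]
      ring
    · simp
  change ‖(centeredIndicator B).1‖ ^ 2 = _
  rw [EuclideanSpace.norm_sq_eq, Finset.sum_congr rfl fun s _ => h s, Finset.sum_add_distrib,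
    ← Finset.mul_sum, sum_ite_mem_card]
  simp
  ring

theorem norm_sq_translate_sub_centeredIndicator (B : Set S) (g : G) :
    ‖zeroSumRep G S g (centeredIndicator B) - centeredIndicator B‖ ^ 2 =
      (Fintype.card S : ℝ) ^ 2 * ((((g⁻¹ • ·) ⁻¹' B) ∆ B).ncard : ℝ) := by
  classical
  have h : ∀ s, ‖(zeroSumRep G S g (centeredIndicator B) - centeredIndicator B).1 s‖ ^ 2 =
      (Fintype.card S : ℝ) ^ 2 * (if s ∈ ((g⁻¹ • ·) ⁻¹' B) ∆ B then 1 else 0) := fun s => by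
    change ‖(zeroSumRep G S g (centeredIndicator B)).1 s - (centeredIndicator B).1 s‖ ^ 2 = _
    rw [zeroSumRep_apply, centeredIndicator_apply, centeredIndicator_apply]
    by_cases h1 : g⁻¹ • s ∈ B <;> by_cases h2 : s ∈ B <;>
      simp [h1, h2, Set.mem_symmDiff, ← neg_add_eq_sub]
  change ‖(zeroSumRep G S g (centeredIndicator B) - centeredIndicator B).1‖ ^ 2 = _
  rw [EuclideanSpace.norm_sq_eq, Finset.sum_congr rfl fun s _ => h s, ← Finset.mul_sum,
    sum_ite_mem_card]

/-- The centred indicator cannot be almost invariant, so some `g ∈ Q` displaces it by at least `ε`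
times its norm; squaring and inserting the two norm formulas gives the bound. -/
theorem isoperimetric_of_invariantVectors [MulAction.IsPretransitive G S]
    {Q : Finset G} {ε : ℝ} (hε : 0 < ε)
    (hQ : (∃ ξ : zeroSum S, IsAlmostInvariantVector (H := zeroSum S) (zeroSumRep G S) (Q : Set G)
      ε ξ) → HasNonzeroInvariantVector (H := zeroSum S) (zeroSumRep G S)) (B : Set S) :
    (B.ncard : ℝ) * ((Fintype.card S : ℝ) - B.ncard) ≤
      (ε ^ 2)⁻¹ * Fintype.card S * ∑ g ∈ Q, ((((g⁻¹ • ·) ⁻¹' B) ∆ B).ncard : ℝ) := by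
  have hN : (0 : ℝ) ≤ Fintype.card S := by positivity
  have hξ := norm_sq_centeredIndicator B
  rcases hN.eq_or_lt with hN0 | hNpos
  · rw [← hN0]
    linarith [mul_self_nonneg (B.ncard : ℝ)]
  have key : ¬ IsAlmostInvariantVector (H := zeroSum S) (zeroSumRep G S) (Q : Set G) ε
      (centeredIndicator B) := fun h =>
    not_hasNonzeroInvariantVector_zeroSumRep (hQ ⟨_, h⟩)
  rw [isAlmostInvariantVector_iff _ Q.finite_toSet hε] at key
  push Not at key
  -- The zero vector fails almost invariance trivially, but then the norm formula makes the
  -- left-hand side vanish.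
  by_cases h0 : centeredIndicator B = 0
  · rw [h0, norm_zero, zero_pow two_ne_zero, eq_comm, mul_eq_zero] at hξ
    rw [hξ.resolve_left hNpos.ne']
    positivity
  obtain ⟨g, hg, hle⟩ := key h0
  have hsq : (ε * ‖centeredIndicator B‖) ^ 2 ≤
      ‖zeroSumRep G S g (centeredIndicator B) - centeredIndicator B‖ ^ 2 :=
    pow_le_pow_left₀ (by positivity) hle 2
  rw [norm_sq_translate_sub_centeredIndicator, mul_pow, hξ] at hsq
  have hterm := Finset.single_le_sum
    (f := fun g => ((((g⁻¹ • ·) ⁻¹' B) ∆ B).ncard : ℝ)) (fun g _ => by positivity) hg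
  rw [mul_assoc, inv_mul_eq_div, le_div_iff₀ (by positivity)]
  refine le_trans ?_ (mul_le_mul_of_nonneg_left hterm hN)
  refine le_of_mul_le_mul_left ?_ hNpos
  linarith

end TransitiveAction

open scoped symmDiff in
/-- A group with property (T) acts on finite transitive sets with a uniform isoperimetric
inequality. -/
theorem HasPropertyT.exists_isoperimetric {G : Type u} [Group G] (hG : HasPropertyT G) :
    ∃ (Q : Finset G) (C : ℝ), 0 ≤ C ∧
      ∀ (S : Type u) [Finite S] [MulAction G S] [MulAction.IsPretransitive G S] (B : Set S),
        (B.ncard : ℝ) * ((Nat.card S : ℝ) - B.ncard) ≤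
          C * Nat.card S * ∑ g ∈ Q, ((((g⁻¹ • ·) ⁻¹' B) ∆ B).ncard : ℝ) := by
  obtain ⟨Q, ε, hε, hQ⟩ := hG
  refine ⟨Q, (ε ^ 2)⁻¹, by positivity, fun S _ _ _ B => ?_⟩
  have := Fintype.ofFinite S
  rw [Nat.card_eq_fintype_card]
  have : CompleteSpace (zeroSum S) := FiniteDimensional.complete ℂ _
  have hS := hQ (zeroSum S) (zeroSumRep G S)
  exact isoperimetric_of_invariantVectors hε hS B

/-! ### Double cosets of a finite-index subgroup and orbits on vertices -/

section OrbitCounting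

variable {G : Type u} [Group G] {V : Type v} [MulAction G V]

/-- The map `G ⧸ L → L \ V`, `gL ↦ L g⁻¹ x`. -/
def cosetToOrbit (L : Subgroup G) (x : V) : G ⧸ L → MulAction.orbitRel.Quotient L V :=
  Quotient.lift (fun g : G => (Quotient.mk'' (g⁻¹ • x) : MulAction.orbitRel.Quotient L V)) (by
    intro g h hgh
    have hmem : g⁻¹ * h ∈ L := QuotientGroup.leftRel_apply.mp hgh
    refine Quotient.sound' ((MulAction.orbitRel_apply).mpr ⟨⟨g⁻¹ * h, hmem⟩, ?_⟩)
    change (g⁻¹ * h) • h⁻¹ • x = g⁻¹ • x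
    rw [smul_smul, mul_assoc, mul_inv_cancel, mul_one])

theorem cosetToOrbit_mk (L : Subgroup G) (x : V) (g : G) :
    cosetToOrbit L x (g : G ⧸ L) = Quotient.mk'' (g⁻¹ • x) := rfl

theorem cosetToOrbit_smul (L : Subgroup G) (x : V) (h : G) (q : G ⧸ L) :
    cosetToOrbit L x (h⁻¹ • q) = cosetToOrbit L (h • x) q := by
  induction q using QuotientGroup.induction_on with
  | H g =>
    change (Quotient.mk'' ((h⁻¹ * g)⁻¹ • x) : MulAction.orbitRel.Quotient L V) = _
    rw [cosetToOrbit_mk, mul_inv_rev, inv_inv, mul_smul]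

theorem orbit_mk_eq_iff {L : Subgroup G} {x y : V} :
    (Quotient.mk'' x : MulAction.orbitRel.Quotient L V) = Quotient.mk'' y ↔
      ∃ l ∈ L, l • y = x := by
  rw [Quotient.eq'', MulAction.orbitRel_apply]
  constructor
  · rintro ⟨l, hl⟩
    exact ⟨l, l.2, hl⟩
  · rintro ⟨l, hl, h⟩
    exact ⟨⟨l, hl⟩, h⟩

/-- If `l g⁻¹ x = g'⁻¹ x` with `l ∈ L`, then `s = g' l g⁻¹` fixes `x` and `g'L = sgL`. The
stabilizer thus sweeps out the whole fibre. -/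
theorem ncard_cosetToOrbit_fiber_le (L : Subgroup G) (x : V)
    [Finite (MulAction.stabilizer G x)] (o : MulAction.orbitRel.Quotient L V) :
    (cosetToOrbit L x ⁻¹' {o}).ncard ≤ Nat.card (MulAction.stabilizer G x) := by
  rcases (cosetToOrbit L x ⁻¹' {o}).eq_empty_or_nonempty with h | ⟨q, hq⟩
  · simp [h]
  induction q using QuotientGroup.induction_on with
  | H g =>
    have hsub : cosetToOrbit L x ⁻¹' {o} ⊆
        Set.range fun s : MulAction.stabilizer G x => ((s * g : G) : G ⧸ L) := by
      intro q' hq'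
      induction q' using QuotientGroup.induction_on with
      | H g' =>
        obtain ⟨l, hl, h⟩ := orbit_mk_eq_iff.mp (hq'.trans hq.symm)
        refine ⟨⟨g' * l * g⁻¹, ?_⟩, ?_⟩
        · rw [MulAction.mem_stabilizer_iff, mul_smul, mul_smul, h, smul_inv_smul]
        · refine QuotientGroup.eq.mpr ?_
          simpa [mul_assoc] using hl
    refine (Set.ncard_le_ncard hsub (Set.finite_range _)).trans ?_
    rw [← Nat.card_coe_set_eq]
    exact Finite.card_range_le _

theorem ncard_preimage_cosetToOrbit_le (L : Subgroup G) [L.FiniteIndex] (x : V)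
    [Finite (MulAction.stabilizer G x)] (T : Set (MulAction.orbitRel.Quotient L V))
    (hT : T.Finite) :
    (cosetToOrbit L x ⁻¹' T).ncard ≤ Nat.card (MulAction.stabilizer G x) * T.ncard := by
  classical
  have := Fintype.ofFinite (G ⧸ L)
  rw [Set.ncard_eq_toFinset_card' (cosetToOrbit L x ⁻¹' T), Set.ncard_eq_toFinset_card T hT]
  refine Finset.card_le_mul_card_image_of_maps_to (f := cosetToOrbit L x) ?_ _ ?_
  · intro a ha
    simpa using ha
  · intro o _
    refine le_trans ?_ (ncard_cosetToOrbit_fiber_le L x o)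
    rw [Set.ncard_eq_toFinset_card']
    refine Finset.card_le_card fun a ha => ?_
    simpa using (Finset.mem_filter.mp ha).2

theorem exists_cosetToOrbit_eq (L : Subgroup G) {R : Finset V}
    (hR : ∀ x : V, ∃ g : G, ∃ r ∈ R, g • r = x) (o : MulAction.orbitRel.Quotient L V) :
    ∃ r ∈ R, ∃ q, cosetToOrbit L r q = o := by
  induction o using Quotient.inductionOn' with
  | h x =>
    obtain ⟨g, r, hr, rfl⟩ := hR x
    exact ⟨r, hr, ((g⁻¹ : G) : G ⧸ L), by rw [cosetToOrbit_mk, inv_inv]⟩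

theorem finite_orbitRel_quotient (L : Subgroup G) [L.FiniteIndex] {R : Finset V}
    (hR : ∀ x : V, ∃ g : G, ∃ r ∈ R, g • r = x) :
    Finite (MulAction.orbitRel.Quotient L V) := by
  refine Finite.of_surjective (fun a : R × (G ⧸ L) => cosetToOrbit L a.1.1 a.2) fun o => ?_
  obtain ⟨r, hr, q, h⟩ := exists_cosetToOrbit_eq L hR o
  exact ⟨(⟨r, hr⟩, q), h⟩

theorem ncard_le_sum_ncard_preimage (L : Subgroup G) [L.FiniteIndex] {R : Finset V}
    (hR : ∀ x : V, ∃ g : G, ∃ r ∈ R, g • r = x) (T : Set (MulAction.orbitRel.Quotient L V)) :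
    T.ncard ≤ ∑ r ∈ R, (cosetToOrbit L r ⁻¹' T).ncard := by
  classical
  have hsub : T ⊆ ⋃ r ∈ R, cosetToOrbit L r '' (cosetToOrbit L r ⁻¹' T) := by
    intro o ho
    obtain ⟨r, hr, q, rfl⟩ := exists_cosetToOrbit_eq L hR o
    exact Set.mem_iUnion₂.mpr ⟨r, hr, q, ho, rfl⟩
  have := finite_orbitRel_quotient L hR
  refine (Set.ncard_le_ncard hsub (Set.toFinite _)).trans ?_
  refine (Finset.set_ncard_biUnion_le _ _).trans (Finset.sum_le_sum fun r _ => ?_)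
  exact Set.ncard_image_le (Set.toFinite _)

end OrbitCounting

/-! ### Coverings -/

namespace SimpleGraph

section Covering

variable {G : Type u} [Group G] {V : Type v} [MulAction G V] {W : Type w}
  {X : SimpleGraph V} {Y : SimpleGraph W} {p : V → W}

/-- The map induced on the orbits of a group of covering transformations. -/
def orbitProj {L : Subgroup G} (hL : ∀ l ∈ L, ∀ x, p (l • x) = p x) :
    MulAction.orbitRel.Quotient L V → W :=
  Quotient.lift p (by
    rintro a b ⟨l, rfl⟩
    exact hL l l.2 b)

theorem orbitProj_mk {L : Subgroup G} (hL : ∀ l ∈ L, ∀ x, p (l • x) = p x) (x : V) :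
    orbitProj hL (Quotient.mk'' x) = p x := rfl

/-- The edge `yz` lifts at every point over `y`, so adjacency relates each orbit over `y` to one
over `z`. Two orbits related to the same one coincide: after translating by `L`, unique lifting
applies at a common endpoint. -/
theorem ncard_orbitProj_fiber_le_of_adj (hX : ∀ (g : G) (x y : V), X.Adj x y → X.Adj (g • x) (g • y))
    (hp : X.IsCoveringMap Y p) {L : Subgroup G} (hL : ∀ l ∈ L, ∀ x, p (l • x) = p x)
    [Finite (MulAction.orbitRel.Quotient L V)] {y z : W} (hyz : Y.Adj y z) :
    (orbitProj hL ⁻¹' {y}).ncard ≤ (orbitProj hL ⁻¹' {z}).ncard := by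
  classical
  have := Fintype.ofFinite (MulAction.orbitRel.Quotient L V)
  rw [Set.ncard_eq_toFinset_card', Set.ncard_eq_toFinset_card']
  refine Finset.card_le_card_of_forall_subsingleton
    (fun o o' => ∃ x x', Quotient.mk'' x = o ∧ Quotient.mk'' x' = o' ∧ X.Adj x x') ?_ ?_
  · intro o ho
    induction o using Quotient.inductionOn' with
    | h x =>
      have hx : p x = y := by simpa [orbitProj_mk] using ho
      subst hx
      obtain ⟨x', hx', rfl⟩ := (hp.bijOn_neighborSet x).surjOn hyz
      exact ⟨Quotient.mk'' x', by simp [orbitProj_mk], x, x', rfl, rfl, hx'⟩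
  · rintro o' - o₁ ⟨h₁, x₁, x₁', rfl, rfl, hadj₁⟩ o₂ ⟨h₂, x₂, x₂', rfl, hx₂', hadj₂⟩
    obtain ⟨l, hl, rfl⟩ := orbit_mk_eq_iff.mp hx₂'
    have hy₁ : p x₁ = y := by simpa [orbitProj_mk] using h₁
    have hy₂ : p x₂ = y := by simpa [orbitProj_mk] using h₂
    have hadj₃ := hX l⁻¹ _ _ hadj₂
    rw [inv_smul_smul] at hadj₃
    have heq : l⁻¹ • x₂ = x₁ := (hp.bijOn_neighborSet x₁').injOn hadj₃.symm hadj₁.symm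
      (by rw [hL _ (inv_mem hl), hy₁, hy₂])
    exact orbit_mk_eq_iff.mpr ⟨l⁻¹, inv_mem hl, heq⟩

theorem ncard_orbitProj_fiber_eq (hX : ∀ (g : G) (x y : V), X.Adj x y → X.Adj (g • x) (g • y))
    (hp : X.IsCoveringMap Y p) {L : Subgroup G} (hL : ∀ l ∈ L, ∀ x, p (l • x) = p x)
    [Finite (MulAction.orbitRel.Quotient L V)] (y z : W) :
    (orbitProj hL ⁻¹' {y}).ncard = (orbitProj hL ⁻¹' {z}).ncard := by
  obtain ⟨c⟩ := hp.connected_target.preconnected y z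
  induction c with
  | nil => rfl
  | cons h _ ih =>
    exact (le_antisymm (ncard_orbitProj_fiber_le_of_adj hX hp hL h)
      (ncard_orbitProj_fiber_le_of_adj hX hp hL h.symm)).trans ih

/-- All fibres of the orbit projection have the same positive cardinality. -/
theorem exists_ncard_preimage_orbitProj [Finite W]
    (hX : ∀ (g : G) (x y : V), X.Adj x y → X.Adj (g • x) (g • y))
    (hp : X.IsCoveringMap Y p) {L : Subgroup G} (hL : ∀ l ∈ L, ∀ x, p (l • x) = p x)
    [Finite (MulAction.orbitRel.Quotient L V)] :
    ∃ m : ℕ, 0 < m ∧ ∀ A : Set W, (orbitProj hL ⁻¹' A).ncard = m * A.ncard := by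
  classical
  obtain ⟨x⟩ := hp.connected_source.nonempty
  refine ⟨(orbitProj hL ⁻¹' {p x}).ncard, ?_, fun A => ?_⟩
  · exact (Set.ncard_pos).mpr ⟨Quotient.mk'' x, rfl⟩
  · have := Fintype.ofFinite (MulAction.orbitRel.Quotient L V)
    have := Fintype.ofFinite W
    rw [Set.ncard_eq_toFinset_card' (orbitProj hL ⁻¹' A), Set.ncard_eq_toFinset_card' A, mul_comm,
      Finset.card_eq_sum_card_fiberwise (f := orbitProj hL) (t := A.toFinset)
        (fun o ho => by simpa using ho)]
    refine Finset.sum_const_nat fun y hy => ?_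
    rw [← ncard_orbitProj_fiber_eq hX hp hL y, Set.ncard_eq_toFinset_card']
    congr 1
    ext o
    simp only [Finset.mem_filter, Set.mem_toFinset, Set.mem_preimage, Set.mem_singleton_iff,
      and_iff_right_iff_imp]
    rintro rfl
    simpa using hy

end Covering

/-- `K` adds up the weights along one chosen walk. It precedes `D` and `t` in the quantifiers, so a
single `K` serves all coverings and all sets `A`. -/
theorem exists_bound_of_edge_bound {V : Type v} {X : SimpleGraph V} (hX : X.Connected)
    (s : V → ℝ) (x y : V) :
    ∃ K : ℝ, 0 ≤ K ∧ ∀ (D : V → V → ℝ) (t : ℝ), (∀ a, D a a = 0) →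
      (∀ a b c, D a c ≤ D a b + D b c) → (∀ a b, X.Adj a b → D a b ≤ (s a + s b) * t) → 0 ≤ t →
      D x y ≤ K * t := by
  obtain ⟨c⟩ := hX.preconnected x y
  induction c with
  | nil => exact ⟨0, le_rfl, fun D t h0 _ _ _ => by simp [h0]⟩
  | @cons a b c h _ ih =>
    obtain ⟨K, hK, hD⟩ := ih
    refine ⟨|s a + s b| + K, by positivity, fun D t h0 htri hedge ht => ?_⟩
    have h1 := htri a b c
    have h2 := hedge a b h
    have h3 := hD D t h0 htri hedge ht
    have h4 := mul_le_mul_of_nonneg_right (le_abs_self (s a + s b)) ht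
    linarith [add_mul |s a + s b| K t]

end SimpleGraph

/-! ### Transfer of the isoperimetric inequality to the base graph -/

namespace SimpleGraph

open scoped symmDiff

section Isoperimetry

variable {G : Type u} [Group G] {V : Type v} [MulAction G V] {W : Type w}
  {X : SimpleGraph V} {Y : SimpleGraph W} {p : V → W}

/-- The cosets `gL` for which `g⁻¹ x` lies over `A`. -/
def visitSet {L : Subgroup G} (hL : ∀ l ∈ L, ∀ x, p (l • x) = p x) (A : Set W) (x : V) :
    Set (G ⧸ L) :=
  cosetToOrbit L x ⁻¹' (orbitProj hL ⁻¹' A)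

theorem mk_mem_visitSet {L : Subgroup G} {hL : ∀ l ∈ L, ∀ x, p (l • x) = p x} {A : Set W} {x : V}
    {g : G} : (g : G ⧸ L) ∈ visitSet hL A x ↔ p (g⁻¹ • x) ∈ A := Iff.rfl

/-- Displacement by an element of `Q` becomes a comparison of two vertices, which walks in `X`
control. -/
theorem preimage_smul_visitSet {L : Subgroup G} (hL : ∀ l ∈ L, ∀ x, p (l • x) = p x) (A : Set W)
    (x : V) (h : G) : (h⁻¹ • ·) ⁻¹' visitSet hL A x = visitSet hL A (h • x) := by
  ext q
  simp only [visitSet, Set.mem_preimage, cosetToOrbit_smul]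

/-- Cosets that distinguish adjacent vertices visit the boundary. -/
theorem visitSet_symmDiff_subset (hX : ∀ (g : G) (x y : V), X.Adj x y → X.Adj (g • x) (g • y))
    (hp : X.IsCoveringMap Y p) {L : Subgroup G} (hL : ∀ l ∈ L, ∀ x, p (l • x) = p x) (A : Set W)
    {x y : V} (hxy : X.Adj x y) :
    visitSet hL A x ∆ visitSet hL A y ⊆
      visitSet hL (Y.vertexBoundary A) x ∪ visitSet hL (Y.vertexBoundary A) y := by
  intro q
  induction q using QuotientGroup.induction_on with
  | H g =>
    have hadj := hp.map_adj (hX g⁻¹ _ _ hxy)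
    simp only [Set.mem_symmDiff, Set.mem_union, mk_mem_visitSet, mem_vertexBoundary]
    rintro (⟨h1, h2⟩ | ⟨h1, h2⟩)
    · exact Or.inr ⟨h2, _, h1, hadj.symm⟩
    · exact Or.inl ⟨h2, _, h1, hadj⟩

theorem ncard_symmDiff_triangle {α : Type*} [Finite α] (A B C : Set α) :
    (A ∆ C).ncard ≤ (A ∆ B).ncard + (B ∆ C).ncard :=
  (Set.ncard_le_ncard (symmDiff_triangle A B C) (Set.toFinite _)).trans (Set.ncard_union_le _ _)

theorem ncard_le_add_ncard_symmDiff {α : Type*} [Finite α] (A B : Set α) :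
    A.ncard ≤ B.ncard + (A ∆ B).ncard := by
  refine (Set.ncard_le_ncard (t := B ∪ A ∆ B) (fun a ha => ?_) (Set.toFinite _)).trans
    (Set.ncard_union_le _ _)
  by_cases hb : a ∈ B
  · exact Or.inl hb
  · exact Or.inr (Or.inl ⟨ha, hb⟩)

/-- An isoperimetric inequality for the base of a covering, from one for a finite quotient of a
group acting on the cover. The constants depend only on the action and on `C`, `Q`. -/
theorem ncard_mul_sub_le_of_isCoveringMap [Finite W]
    (hX : ∀ (g : G) (x y : V), X.Adj x y → X.Adj (g • x) (g • y))
    (hp : X.IsCoveringMap Y p) {L : Subgroup G} [L.FiniteIndex]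
    (hL : ∀ l ∈ L, ∀ x, p (l • x) = p x)
    [∀ x : V, Finite (MulAction.stabilizer G x)]
    {R : Finset V} (hR : ∀ x : V, ∃ g : G, ∃ r ∈ R, g • r = x) (x₀ : V)
    {Q : Finset G} {C : ℝ} (hC : 0 ≤ C)
    (hiso : ∀ B : Set (G ⧸ L), (B.ncard : ℝ) * ((Nat.card (G ⧸ L) : ℝ) - B.ncard) ≤
      C * Nat.card (G ⧸ L) * ∑ g ∈ Q, ((((g⁻¹ • ·) ⁻¹' B) ∆ B).ncard : ℝ))
    {K : V → V → ℝ} (hK : ∀ x y, 0 ≤ K x y ∧ ∀ (D : V → V → ℝ) (t : ℝ), (∀ a, D a a = 0) →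
      (∀ a b c, D a c ≤ D a b + D b c) →
      (∀ a b, X.Adj a b → D a b ≤ ((Nat.card (MulAction.stabilizer G a) : ℝ) +
        Nat.card (MulAction.stabilizer G b)) * t) → 0 ≤ t → D x y ≤ K x y * t)
    (A : Set W) :
    (A.ncard : ℝ) * ((Nat.card W : ℝ) - A.ncard) ≤
      (Nat.card (MulAction.stabilizer G x₀) *
        ∑ i ∈ R, ∑ j ∈ R, (C * ∑ g ∈ Q, K (g • i) i + K i j)) *
      Nat.card W * (Y.vertexBoundary A).ncard := by
  have hfin := finite_orbitRel_quotient L hR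
  obtain ⟨m, hm, hcard⟩ := exists_ncard_preimage_orbitProj hX hp hL
  set N : ℝ := (Nat.card (G ⧸ L) : ℝ) with hN
  set t : ℝ := (m : ℝ) * (Y.vertexBoundary A).ncard with ht
  have ht0 : 0 ≤ t := by positivity
  have hN0 : 0 ≤ N := by positivity
  have hm' : (0 : ℝ) < m := by exact_mod_cast hm
  let b : V → ℝ := fun x => ((visitSet hL A x).ncard : ℝ)
  have hbN : ∀ x, b x ≤ N := fun x => by
    exact Nat.cast_le.mpr (Set.ncard_le_card (visitSet hL A x))
  have hD : ∀ x y, ((visitSet hL A x ∆ visitSet hL A y).ncard : ℝ) ≤ K x y * t := by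
    intro x y
    refine (hK x y).2 (fun x y => ((visitSet hL A x ∆ visitSet hL A y).ncard : ℝ)) t ?_ ?_ ?_ ht0
    · simp
    · intro a b c
      exact_mod_cast ncard_symmDiff_triangle _ _ _
    · intro a b hab
      have h1 := (Set.ncard_le_ncard (visitSet_symmDiff_subset hX hp hL A hab)
        (Set.toFinite _)).trans (Set.ncard_union_le _ _)
      have h2 := ncard_preimage_cosetToOrbit_le L a (orbitProj hL ⁻¹' Y.vertexBoundary A)
        (Set.toFinite _)
      have h3 := ncard_preimage_cosetToOrbit_le L b (orbitProj hL ⁻¹' Y.vertexBoundary A)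
        (Set.toFinite _)
      rw [hcard] at h2 h3
      have h4 := h1.trans (add_le_add h2 h3)
      have h5 := (Nat.cast_le (α := ℝ)).mpr h4
      push_cast at h5
      rw [ht, add_mul]
      exact h5
  have e1 : (m : ℝ) * A.ncard ≤ ∑ r ∈ R, b r := by
    have h := ncard_le_sum_ncard_preimage L hR (orbitProj hL ⁻¹' A)
    rw [hcard, ← Nat.cast_le (α := ℝ)] at h
    push_cast at h
    exact h
  have e2 : (m : ℝ) * (Nat.card W - A.ncard) ≤ ∑ r ∈ R, (N - b r) := by
    have h := ncard_le_sum_ncard_preimage L hR (orbitProj hL ⁻¹' Aᶜ)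
    rw [hcard] at h
    have h1 : ((Aᶜ).ncard : ℝ) = Nat.card W - A.ncard := by
      rw [← Set.ncard_add_ncard_compl A]
      push_cast
      ring
    have h2 : ∀ r, ((cosetToOrbit L r ⁻¹' (orbitProj hL ⁻¹' Aᶜ)).ncard : ℝ) = N - b r := by
      intro r
      have h3 := Set.ncard_add_ncard_compl (visitSet hL A r)
      rw [hN, ← h3, Nat.cast_add, add_sub_cancel_left]
      rfl
    rw [← h1, ← Finset.sum_congr rfl fun r _ => h2 r]
    exact_mod_cast h
  have e3 : N ≤ Nat.card (MulAction.stabilizer G x₀) * (m * Nat.card W) := by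
    have h := ncard_preimage_cosetToOrbit_le L x₀ (orbitProj hL ⁻¹' Set.univ) (Set.toFinite _)
    rw [hcard, Set.preimage_univ, Set.preimage_univ, Set.ncard_univ, Set.ncard_univ,
      ← Nat.cast_le (α := ℝ)] at h
    push_cast at h
    exact h
  -- Split `N - b j = (N - b i) + (b i - b j)`: `hiso` bounds the first part, the walk estimate `hD
  -- i j` the second.
  have e4 : ∀ i j, b i * (N - b j) ≤ (C * ∑ g ∈ Q, K (g • i) i + K i j) * (N * t) := by
    intro i j
    have h1 := hiso (visitSet hL A i)
    simp only [preimage_smul_visitSet] at h1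
    have h2 : ∑ g ∈ Q, ((visitSet hL A (g • i) ∆ visitSet hL A i).ncard : ℝ) ≤
        (∑ g ∈ Q, K (g • i) i) * t := by
      rw [Finset.sum_mul]
      exact Finset.sum_le_sum fun g _ => hD _ _
    have h3 := h1.trans (mul_le_mul_of_nonneg_left h2 (by positivity))
    have h4 : b i ≤ b j + K i j * t := by
      have h5 : b i ≤ b j + (visitSet hL A i ∆ visitSet hL A j).ncard := by
        have h6 := ncard_le_add_ncard_symmDiff (visitSet hL A i) (visitSet hL A j)
        rw [← Nat.cast_le (α := ℝ), Nat.cast_add] at h6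
        exact h6
      linarith [hD i j]
    have h6 : b i * (b i - b j) ≤ N * (K i j * t) := by
      have h7 : b i * (b i - b j) ≤ b i * (K i j * t) :=
        mul_le_mul_of_nonneg_left (by linarith) (by positivity)
      exact h7.trans (mul_le_mul_of_nonneg_right (hbN i) (mul_nonneg (hK i j).1 ht0))
    change b i * (N - b i) ≤ _ at h3
    linarith
  set M : ℝ := ∑ i ∈ R, ∑ j ∈ R, (C * ∑ g ∈ Q, K (g • i) i + K i j) with hM
  have hM0 : 0 ≤ M := Finset.sum_nonneg fun i _ => Finset.sum_nonneg fun j _ =>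
    add_nonneg (mul_nonneg hC (Finset.sum_nonneg fun g _ => (hK _ _).1)) (hK _ _).1
  have h5 : (∑ r ∈ R, b r) * ∑ r ∈ R, (N - b r) ≤ M * (N * t) := by
    rw [Finset.sum_mul_sum, hM, Finset.sum_mul]
    refine Finset.sum_le_sum fun i _ => ?_
    rw [Finset.sum_mul]
    exact Finset.sum_le_sum fun j _ => e4 i j
  have h6 : (m : ℝ) * A.ncard * (m * (Nat.card W - A.ncard)) ≤ M * (N * t) := by
    refine (mul_le_mul e1 e2 ?_ (Finset.sum_nonneg fun _ _ => by positivity)).trans h5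
    have := Set.ncard_le_card A
    exact mul_nonneg hm'.le (sub_nonneg.mpr (by exact_mod_cast this))
  -- Both `t` and the bound `e3` on `N` carry a factor `m`, matching the `m * m` on the left.
  have h7 := h6.trans (mul_le_mul_of_nonneg_left (mul_le_mul_of_nonneg_right e3 ht0) hM0)
  refine le_of_mul_le_mul_left ?_ (mul_pos hm' hm')
  rw [ht] at h7
  linarith

end Isoperimetry

theorem isExpander_of_mul_sub_le {W : Type v} [Finite W] {Y : SimpleGraph W} {k : ℕ}
    (hreg : Y.IsKRegular k) {M : ℝ} (hM : 0 ≤ M)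
    (h : ∀ A : Set W, (A.ncard : ℝ) * ((Nat.card W : ℝ) - A.ncard) ≤
      M * Nat.card W * (Y.vertexBoundary A).ncard) :
    Y.IsExpander (Nat.card W) k (M + 1)⁻¹ where
  finite := inferInstance
  card_eq := rfl
  regular := hreg
  boundary_ge A := by
    rcases isEmpty_or_nonempty W with hW | hW
    · simp [Set.eq_empty_of_isEmpty A]
    have hn : (0 : ℝ) < Nat.card W := by exact_mod_cast Nat.card_pos
    have hδ : (0 : ℝ) ≤ (Y.vertexBoundary A).ncard := by positivity
    -- The shift to `M + 1` keeps the constant positive when `M = 0`.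
    rw [mul_assoc, inv_mul_le_iff₀ (by positivity), one_sub_div hn.ne', div_mul_eq_mul_div,
      div_le_iff₀ hn]
    have := h A
    nlinarith [mul_nonneg hn.le hδ]

end SimpleGraph

theorem proposition6p1 {V : Type u} (X : SimpleGraph V) (Γ : Subgroup (X ≃g X))
    (hX : X.IsKazhdanGraphStructure Γ) (k : ℕ)
    {I : Type w} {W : I → Type v} [∀ i, Finite (W i)] (Y : ∀ i, SimpleGraph (W i))
    (hreg : ∀ i, (Y i).IsKRegular k)
    (hcov : ∀ i, ∃ p : V → W i, X.IsCoveringMap (Y i) p ∧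
      X.Cov p ≤ Γ ∧ ((X.Cov p).subgroupOf Γ).FiniteIndex) :
    X.HasPropertyTau Y := by
  classical
  refine ⟨fun i => (hcov i).imp fun p hp => hp.1, k, ?_⟩
  -- Connectedness of `X` is only available from a covering, so the empty family is treated apart.
  rcases isEmpty_or_nonempty I with hI | ⟨⟨i₀⟩⟩
  · exact ⟨1, one_pos, fun i => isEmptyElim i⟩
  have hconn : X.Connected := (hcov i₀).choose_spec.1.connected_source
  obtain ⟨x₀⟩ := hconn.nonempty
  have hstab := hX.finite_stabilizer
  have := hX.finite_orbits
  have := Fintype.ofFinite (MulAction.orbitRel.Quotient Γ V)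
  obtain ⟨Q, C, hC, hiso⟩ := hX.propertyT.exists_isoperimetric
  choose K hK using fun x y : V => SimpleGraph.exists_bound_of_edge_bound hconn
    (fun z => (Nat.card (MulAction.stabilizer Γ z) : ℝ)) x y
  let R : Finset V :=
    (Finset.univ : Finset (MulAction.orbitRel.Quotient Γ V)).image Quotient.out
  have hR : ∀ x : V, ∃ g : Γ, ∃ r ∈ R, g • r = x := by
    intro x
    obtain ⟨g, hg⟩ := MulAction.orbitRel_apply.mp
      ((MulAction.orbitRel Γ V).symm (Quotient.mk_out (s := MulAction.orbitRel Γ V) x))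
    exact ⟨g, _, Finset.mem_image_of_mem _ (Finset.mem_univ _), hg⟩
  set M : ℝ := Nat.card (MulAction.stabilizer Γ x₀) *
    ∑ i ∈ R, ∑ j ∈ R, (C * ∑ g ∈ Q, K (g • i) i + K i j)
  have hM : 0 ≤ M := mul_nonneg (by positivity) (Finset.sum_nonneg fun i _ =>
    Finset.sum_nonneg fun j _ => add_nonneg
      (mul_nonneg hC (Finset.sum_nonneg fun g _ => (hK _ _).1)) (hK _ _).1)
  refine ⟨(M + 1)⁻¹, by positivity, fun i => SimpleGraph.isExpander_of_mul_sub_le (hreg i) hM ?_⟩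
  obtain ⟨p, hp, -, hfin⟩ := hcov i
  exact SimpleGraph.ncard_mul_sub_le_of_isCoveringMap (G := Γ)
    (fun g x y hxy => (g : X ≃g X).map_rel_iff.mpr hxy) hp
    (L := (X.Cov p).subgroupOf Γ) (fun l hl x => congrFun hl x) hR x₀ hC
    (fun B => hiso _ B) hK
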